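/- For a matrix $M$, a set $R$ of columns resolves $M$ if the rows of $M$ restricted to the columns in $R$ are pairwise distinct; $\beta(M)$ denotes the minimal cardinality of a set of columns resolving $M$ ($+\infty$ if there is none, i.e. if $M$ has two identical rows). For $p=p_n\in[0,1]$, possibly depending on $n$, let $G_{n,p}$ be the Erdős–Rényi random graph on $n$ vertices, in which each pair of distinct vertices is joined by an edge with probability $p$, independently of all other pairs. Let $A_{n,p}$ be its adjacency matrix and $A^*_{n,p}:=A_{n,p}+2I_n$. Let $q=\min\{p,1-p\}$; "with high probability" means with probability tending to $1$ as $n\to\infty$, and all asymptotic relations are for $n\to\infty$. (i) If $\frac{\ln n}{n}=o(q)$, then with high probability $$\beta(A^*_{n,p})\le\left\lceil\frac{-2\ln n}{\ln\left(p^2+(1-p)^2\right)}\right\rceil.$$ (ii) If $\frac{\ln^2 n}{n^{1-C/2}}=o(q)$ for some constant $1<C<2$, then with high probability $$\beta(A^*_{n,p})\ge\left\lfloor\frac{-C\ln n}{\ln\left(p^2+(1-p)^2\right)}\right\rfloor.$$ -/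

import Mathlib

open scoped Asymptotics

/-- A set `R` of columns resolves the matrix `M` if the rows of `M`, restricted to the columns
in `R`, are pairwise distinct. -/
def Matrix.Resolves {m n α : Type*} (M : Matrix m n α) (R : Set n) : Prop :=
  ∀ u v : m, u ≠ v → ∃ r ∈ R, M u r ≠ M v r

/-- The metric dimension of a matrix: the least number of columns in a resolving set of columns,
and `⊤` when no set of columns resolves the matrix (i.e. when two rows are identical). -/
noncomputable def Matrix.metricDim {m n α : Type*} (M : Matrix m n α) : ℕ∞ :=
  ⨅ (R : Set n) (_ : M.Resolves R), R.encard

open Classical in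
/-- The matrix `A* = A + diag(2)`, where `A` is the adjacency matrix of the graph `G`. -/
noncomputable def SimpleGraph.adjMatrixStar {V : Type*} (G : SimpleGraph V) : Matrix V V ℕ :=
  G.adjMatrix ℕ + Matrix.diagonal (fun _ => 2)

open MeasureTheory ProbabilityTheory unitInterval

/-!
Write `Q = p ^ 2 + (1 - p) ^ 2` and `q = min p (1 - p)`, so that `- log Q ≥ q`. Because of the
entries `2` on the diagonal of `A*`, a vertex in a set `R` of columns is separated by `R` from every
other vertex, and two vertices outside `R` are separated unless they have the same neighbours in
`R`. The edges concerned are independent, so the latter happens with probability `Q ^ |R|`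
(`SimpleGraph.measureReal_adj_iff_adj`).

*Upper bound.* For `r = ⌈2 log n / (- log Q)⌉` we have `Q ^ r ≤ n ^ (-2)`, so a fixed set of `r`
columns fails to resolve `A*` with probability at most `1 / 2`. This is not enough, so `k` disjoint
sets `R₁, …, R_k` of `r` columns are used. Let `W` be the complement of their union. The events
that `R_i` fails to separate two vertices in `W` depend on disjoint sets of edges, hence all of them
occur with probability at most `2 ^ (-k)`. The other collisions on some `R_i` involve a vertex of
another `R_j`, and the expected number of those is at most `k ^ 2 * r * n * Q ^ r ≤ k ^ 2 * r / n`,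
which tends to `0` because `r = o(n)`
(`SimpleGraph.measureReal_not_exists_resolves_le`). As `k` is arbitrary, the claim follows.

*Lower bound.* Let `m + 1 = ⌊C log n / (- log Q)⌋`. If the metric dimension is at most `m`, then some
set `R` of exactly `m` columns resolves `A*`, so the `N = n - m` rows outside `R`, which are
independent samples from a distribution `π` on `{0, 1} ^ R` with `∑ π ^ 2 = Q ^ m`, are distinct.
The probability of that is `N!` times an elementary symmetric polynomial in the values of `π`. It is
at most `N! * N ^ (-N) * ∏ (1 + N * π x)`, and no value of `π` exceeds `s = Q ^ (m / 2)`, which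
bounds the product; the result is `e * N * exp (- N * s / 8)` (`sum_injective_prod_le_exp`). Since
`s ≥ n ^ (- C / 2)`, the exponent is of order `n ^ (1 - C / 2)`, which by hypothesis beats the
factor `n ^ m` of the union bound over `R` (`pow_mul_exp_le_exp_neg`).
-/

/-! ### Edges of the binomial random graph -/

/-- The probability that a Bernoulli variable with parameter `p` takes the value `b`. -/
def bernoulliWeight (p : ℝ) (b : Bool) : ℝ := if b then p else 1 - p

lemma bernoulliWeight_nonneg {p : ℝ} (h0 : 0 ≤ p) (h1 : p ≤ 1) (b : Bool) :
    0 ≤ bernoulliWeight p b := by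
  cases b <;> simp [bernoulliWeight, h0, h1]

lemma sum_bernoulliWeight_sq (p : ℝ) : ∑ b, bernoulliWeight p b ^ 2 = p ^ 2 + (1 - p) ^ 2 := by
  simp [bernoulliWeight]

namespace SimpleGraph
variable {V : Type*}

lemma measurable_fromEdgeSet_ofPred :
    Measurable (fun t : Sym2 V → Prop ↦ fromEdgeSet {e | t e}) :=
  measurable_fromEdgeSet.comp (by fun_prop)

open Classical in
/-- The indicators, as Booleans, of the presence of the edges `e i` in the graph `G`. -/
noncomputable def edgeIndicator {ι : Type*} (e : ι → Sym2 V) (G : SimpleGraph V) : ι → Bool :=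
  fun i ↦ decide (e i ∈ G.edgeSet)

lemma edgeIndicator_eq_iff {ι : Type*} {e : ι → Sym2 V} {G : SimpleGraph V} {f : ι → Bool} :
    edgeIndicator e G = f ↔ ∀ i, (e i ∈ G.edgeSet ↔ f i = true) := by
  simp only [funext_iff, edgeIndicator]
  refine forall_congr' fun i ↦ ?_
  cases f i <;> simp

lemma measurable_edgeIndicator {ι : Type*} (e : ι → Sym2 V) :
    Measurable (edgeIndicator (V := V) e) := by
  refine measurable_pi_iff.2 fun i ↦ ?_
  convert! (measurable_from_top (f := fun q : Prop ↦ @decide q (Classical.propDecidable q))).comp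
    (measurable_set_iff.1 measurable_edgeSet (e i))
  simp [edgeIndicator]

variable [Countable V] (p : I)

lemma binomialRandom_eq_map_infinitePi :
    binomialRandom V p = Measure.map (fun t : Sym2 V → Prop ↦ fromEdgeSet {e | t e})
      (Measure.infinitePi fun e : Sym2 V ↦
        toNNReal p • Measure.dirac (e ∈ Sym2.diagSetᶜ) + toNNReal (σ p) • Measure.dirac False) := by
  rw [binomialRandom_eq_map, setBernoulli_eq_map, Measure.map_map (by fun_prop) (by fun_prop)]
  rfl

/-- The edges of the binomial random graph are present independently of each other. For a loop the
event is empty, which is why all of `Sym2 V` may serve as the index type. -/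
lemma iIndepFun_mem_edgeSet :
    iIndepFun (fun (e : Sym2 V) (G : SimpleGraph V) ↦ e ∈ G.edgeSet) (binomialRandom V p) := by
  rw [iIndepFun_iff_measure_inter_preimage_eq_mul]
  intro S sets _
  have hm (e : Sym2 V) : Measurable fun G : SimpleGraph V ↦ e ∈ G.edgeSet :=
    measurable_set_iff.1 measurable_edgeSet e
  have hs (e : Sym2 V) : MeasurableSet ((fun G : SimpleGraph V ↦ e ∈ G.edgeSet) ⁻¹' sets e) :=
    hm e (.of_discrete)
  have key := (iIndepFun_infinitePi (P := fun e : Sym2 V ↦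
        toNNReal p • Measure.dirac (e ∈ Sym2.diagSetᶜ) + toNNReal (σ p) • Measure.dirac False)
      (X := fun e (x : Prop) ↦ x ∧ ¬ e.IsDiag)
      (fun e ↦ measurable_from_top)).measure_inter_preimage_eq_mul S (sets := sets)
      (fun _ _ ↦ .of_discrete)
  have hpre (e : Sym2 V) : (fun t : Sym2 V → Prop ↦ fromEdgeSet {e | t e}) ⁻¹'
      ((fun G : SimpleGraph V ↦ e ∈ G.edgeSet) ⁻¹' sets e) =
      (fun t : Sym2 V → Prop ↦ t e ∧ ¬ e.IsDiag) ⁻¹' sets e := by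
    ext t
    simp [Set.mem_preimage]
  rw [binomialRandom_eq_map_infinitePi,
    Measure.map_apply measurable_fromEdgeSet_ofPred (S.measurableSet_biInter fun e _ ↦ hs e),
    Set.preimage_iInter₂]
  simp_rw [Measure.map_apply measurable_fromEdgeSet_ofPred (hs _), hpre]
  exact key

lemma measureReal_mem_edgeSet {e : Sym2 V} (he : ¬ e.IsDiag) :
    (binomialRandom V p).real {G | e ∈ G.edgeSet} = p := by
  have hm : Measurable fun G : SimpleGraph V ↦ e ∈ G.edgeSet :=
    measurable_set_iff.1 measurable_edgeSet e
  have hpre : (fun t : Sym2 V → Prop ↦ fromEdgeSet {e | t e}) ⁻¹' {G | e ∈ G.edgeSet} =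
      (fun t ↦ t e) ⁻¹' {True} := by
    ext t
    simp [he]
  rw [measureReal_def, binomialRandom_eq_map_infinitePi,
    Measure.map_apply measurable_fromEdgeSet_ofPred (measurableSet_setOfPred.2 hm), hpre,
    ← Measure.map_apply (measurable_pi_apply e) .of_discrete, Measure.infinitePi_map_eval]
  simp [he]

lemma measureReal_edgeIndicator_eq {ι : Type*} [Fintype ι] {e : ι → Sym2 V}
    (he : Function.Injective e) (hd : ∀ i, ¬ (e i).IsDiag) (f : ι → Bool) :
    (binomialRandom V p).real {G | edgeIndicator e G = f} = ∏ i, bernoulliWeight p (f i) := by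
  have h := ((iIndepFun_mem_edgeSet (V := V) p).precomp he).measure_inter_preimage_eq_mul
    Finset.univ (sets := fun i ↦ {q : Prop | q ↔ f i = true}) (fun _ _ ↦ .of_discrete)
  have h1 : {G : SimpleGraph V | edgeIndicator e G = f} =
      ⋂ i ∈ (Finset.univ : Finset ι), (fun G : SimpleGraph V ↦ e i ∈ G.edgeSet) ⁻¹'
        {q : Prop | q ↔ f i = true} := by
    ext G
    simp [edgeIndicator_eq_iff]
  rw [measureReal_def, h1, h, ENNReal.toReal_prod]
  refine Finset.prod_congr rfl fun i _ ↦ ?_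
  rw [← measureReal_def]
  have hp := measureReal_mem_edgeSet p (hd i)
  cases hf : f i
  · have : (fun G : SimpleGraph V ↦ e i ∈ G.edgeSet) ⁻¹' {q : Prop | q ↔ false = true} =
        {G : SimpleGraph V | e i ∈ G.edgeSet}ᶜ := by ext G; simp
    rw [this, probReal_compl_eq_one_sub
      (measurableSet_setOfPred.2 (measurable_set_iff.1 measurable_edgeSet (e i))), hp]
    simp [bernoulliWeight]
  · have : (fun G : SimpleGraph V ↦ e i ∈ G.edgeSet) ⁻¹' {q : Prop | q ↔ true = true} =
        {G : SimpleGraph V | e i ∈ G.edgeSet} := by ext G; simp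
    rw [this, hp]
    simp [bernoulliWeight]

lemma measureReal_edgeIndicator_mem {ι : Type*} [Fintype ι] [DecidableEq ι] {e : ι → Sym2 V}
    (he : Function.Injective e) (hd : ∀ i, ¬ (e i).IsDiag) (S : Set (ι → Bool))
    [DecidablePred (· ∈ S)] :
    (binomialRandom V p).real {G | edgeIndicator e G ∈ S} =
      ∑ f with f ∈ S, ∏ i, bernoulliWeight p (f i) := by
  simp_rw [← measureReal_edgeIndicator_eq p he hd]
  have := sum_measureReal_preimage_singleton (μ := binomialRandom V p)
    (Finset.univ.filter (· ∈ S)) (f := edgeIndicator (V := V) e)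
    (fun y _ ↦ measurable_edgeIndicator e .of_discrete)
  rw [show {G : SimpleGraph V | edgeIndicator e G ∈ S} =
    edgeIndicator (V := V) e ⁻¹' ↑(Finset.univ.filter (· ∈ S)) by ext; simp, ← this]
  rfl

/-- Events that depend on pairwise disjoint families of edges are independent. -/
lemma measureReal_forall_edgeIndicator_mem {κ ι : Type*} [Fintype κ] [Fintype ι]
    {e : κ → ι → Sym2 V} (he : Function.Injective (Function.uncurry e))
    (hd : ∀ k i, ¬ (e k i).IsDiag) (S : κ → Set (ι → Bool)) :
    (binomialRandom V p).real {G | ∀ k, edgeIndicator (e k) G ∈ S k} =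
      ∏ k, (binomialRandom V p).real {G | edgeIndicator (e k) G ∈ S k} := by
  classical
  have h1 := measureReal_edgeIndicator_mem p he (fun x ↦ hd x.1 x.2)
    {g | ∀ k, Function.curry g k ∈ S k}
  have h2 (k : κ) := measureReal_edgeIndicator_mem p (e := e k)
    (fun i j hij ↦ (Prod.ext_iff.1 (@he (k, i) (k, j) hij)).2) (hd k) (S k)
  simp_rw [h2, Finset.prod_univ_sum]
  refine h1.trans ?_
  refine Finset.sum_equiv (Equiv.curry κ ι Bool) (fun g ↦ ?_) (fun g _ ↦ ?_)
  · simp [Fintype.mem_piFinset]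
  · rw [Fintype.prod_prod_type]
    rfl

/-- Two fixed vertices have the same neighbours among `|κ|` other vertices with probability
`(p ^ 2 + (1 - p) ^ 2) ^ |κ|`. -/
lemma measureReal_adj_iff_adj {κ : Type*} [Fintype κ] {R : κ → V}
    (hR : Function.Injective R) {u v : V} (huv : u ≠ v) (hu : ∀ i, R i ≠ u) (hv : ∀ i, R i ≠ v) :
    (binomialRandom V p).real {G | ∀ i, (G.Adj u (R i) ↔ G.Adj v (R i))} =
      ((p : ℝ) ^ 2 + (1 - p) ^ 2) ^ Fintype.card κ := by
  classical
  let e : κ → Bool → Sym2 V := fun i b ↦ s(if b then u else v, R i)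
  have hd (i : κ) (b : Bool) : ¬ (e i b).IsDiag := by
    cases b
    · simpa [e] using (hv i).symm
    · simpa [e] using (hu i).symm
  have he : Function.Injective (Function.uncurry e) := by
    rintro ⟨i, b⟩ ⟨j, c⟩ h
    have h1 := hu i; have h2 := hu j; have h3 := hv i; have h4 := hv j
    have h5 := @hR i j
    cases b <;> cases c <;> simp [e, Function.uncurry] at h ⊢ <;> grind
  -- The pairs of edges `{u R i, v R i}` are disjoint, so the events "both edges have the same
  -- status" are independent, and each has probability `p ^ 2 + (1 - p) ^ 2`.
  have h1 := measureReal_forall_edgeIndicator_mem p he hd (fun _ ↦ {g | g true = g false})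
  have h2 (i : κ) := measureReal_edgeIndicator_mem p (e := e i)
    (fun a b hab ↦ (Prod.ext_iff.1 (@he (i, a) (i, b) hab)).2) (hd i) {g | g true = g false}
  have h3 : ∑ f : Bool → Bool with f ∈ {g : Bool → Bool | g true = g false},
      ∏ i, bernoulliWeight p (f i) = (p : ℝ) ^ 2 + (1 - p) ^ 2 := by
    rw [← sum_bernoulliWeight_sq]
    symm
    refine Finset.sum_bij (fun b _ ↦ fun _ ↦ b) (by simp)
      (fun a _ b _ h ↦ congrFun h true) (fun f hf ↦ ⟨f true, by simp, ?_⟩) (fun b _ ↦ ?_)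
    · simp only [Finset.mem_filter, Set.mem_ofPred_eq] at hf
      ext x
      cases x
      · simp [hf.2]
      · simp
    · simp [sq]
  have h4 : {G : SimpleGraph V | ∀ i, (G.Adj u (R i) ↔ G.Adj v (R i))} =
      {G | ∀ i, edgeIndicator (e i) G ∈ {g | g true = g false}} := by
    ext G
    simp [edgeIndicator, e]
  rw [h4, h1, Finset.prod_congr rfl fun i _ ↦ (h2 i).trans h3]
  simp

end SimpleGraph

/-! ### Distinctness of independent samples -/

lemma one_add_le_exp_sub_sq_div {y : ℝ} (hy : 0 ≤ y) :
    1 + y ≤ Real.exp (y - y ^ 2 / (4 * (1 + y))) := by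
  have h1 : (0 : ℝ) < 1 + y := by positivity
  have hz : y - y ^ 2 / (4 * (1 + y)) = y * (4 + 3 * y) / (4 * (1 + y)) := by
    field_simp
    ring
  have hz0 : 0 ≤ y - y ^ 2 / (4 * (1 + y)) := by
    rw [hz]
    positivity
  refine le_trans ?_ (Real.quadratic_le_exp_of_nonneg hz0)
  have h2 : y ^ 2 / (4 * (1 + y)) ≤ (y * (4 + 3 * y) / (4 * (1 + y))) ^ 2 / 2 := by
    rw [div_pow, div_div, div_le_div_iff₀ (by positivity) (by positivity)]
    have : 0 ≤ y ^ 2 * (1 + y) * (8 + 16 * y + 9 * y ^ 2) := by positivity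
    nlinarith
  rw [← hz] at h2
  linarith

/-- A quantitative form of `∏ x, (1 + t * π x) ≤ exp t`: the saving in the exponent is of order
`min (t * s) ((t * s) ^ 2)`, where `s ^ 2` is the collision probability of `π`. -/
lemma prod_one_add_le_exp {X : Type*} [Fintype X] {π : X → ℝ} (h0 : ∀ x, 0 ≤ π x)
    (h1 : ∑ x, π x = 1) {s t : ℝ} (hs : 0 ≤ s) (hs2 : ∑ x, π x ^ 2 = s ^ 2) (ht : 0 ≤ t) :
    ∏ x, (1 + t * π x) ≤ Real.exp (t - (t * s) ^ 2 / (4 * (1 + t * s))) := by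
  -- No atom exceeds `s`, because `π x ^ 2` is one of the terms of `∑ x, π x ^ 2 = s ^ 2`.
  have hle (x : X) : π x ≤ s := by
    refine le_of_sq_le_sq ?_ hs
    rw [← hs2]
    exact Finset.single_le_sum (f := fun x ↦ π x ^ 2) (fun _ _ ↦ sq_nonneg _) (Finset.mem_univ x)
  have hx (x : X) : 1 + t * π x ≤
      Real.exp (t * π x - t ^ 2 / (4 * (1 + t * s)) * π x ^ 2) := by
    have htx : 0 ≤ t * π x := mul_nonneg ht (h0 x)
    have hts : t * π x ≤ t * s := mul_le_mul_of_nonneg_left (hle x) ht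
    refine (one_add_le_exp_sub_sq_div htx).trans (Real.exp_le_exp.2 (sub_le_sub_left ?_ _))
    rw [div_mul_eq_mul_div, mul_pow]
    gcongr
  refine (Finset.prod_le_prod (fun x _ ↦ ?_) fun x _ ↦ hx x).trans (le_of_eq ?_)
  · have := mul_nonneg ht (h0 x)
    positivity
  · rw [← Real.exp_sum, Finset.sum_sub_distrib, ← Finset.mul_sum, ← Finset.mul_sum, h1, hs2]
    congr 1
    ring

/-- A weak form of Stirling's bound, `N! ≤ e N (N / e) ^ N`. -/
lemma factorial_mul_exp_le {N : ℕ} (hN : 1 ≤ N) :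
    (N.factorial : ℝ) * Real.exp N ≤ Real.exp 1 * N * (N : ℝ) ^ N := by
  induction N, hN using Nat.le_induction with
  | base => simp
  | succ N hN ih =>
    have hN0 : (0 : ℝ) < N := by exact_mod_cast hN
    -- `e ≤ (1 + 1 / N) ^ (N + 1)`
    have key : Real.exp 1 * (N : ℝ) ^ (N + 1) ≤ ((N : ℝ) + 1) ^ (N + 1) := by
      have h := Real.one_sub_inv_le_log_of_pos (x := ((N : ℝ) + 1) / N) (by positivity)
      have h2 : 1 - (((N : ℝ) + 1) / N)⁻¹ = 1 / (N + 1) := by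
        field_simp
        ring
      rw [h2, div_le_iff₀ (by positivity)] at h
      have h3 : Real.exp 1 ≤ (((N : ℝ) + 1) / N) ^ (N + 1) := by
        rw [← Real.le_log_iff_exp_le (by positivity), Real.log_pow]
        push_cast
        linarith
      rwa [div_pow, le_div_iff₀ (by positivity)] at h3
    have h4 : ((N + 1).factorial : ℝ) * Real.exp ((N + 1 : ℕ) : ℝ) =
        (N + 1) * Real.exp 1 * (N.factorial * Real.exp N) := by
      push_cast [Nat.factorial_succ]
      rw [Real.exp_add]
      ring
    rw [h4]
    push_cast
    calc ((N : ℝ) + 1) * Real.exp 1 * (N.factorial * Real.exp N)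
        ≤ (N + 1) * Real.exp 1 * (Real.exp 1 * N * (N : ℝ) ^ N) := by gcongr
      _ = Real.exp 1 * (N + 1) * (Real.exp 1 * (N : ℝ) ^ (N + 1)) := by ring
      _ ≤ Real.exp 1 * (N + 1) * ((N : ℝ) + 1) ^ (N + 1) := by gcongr

/-- The sum over injective functions is `|W|!` times the elementary symmetric polynomial of degree
`|W|` in the numbers `π x`, hence is controlled by their generating polynomial. -/
lemma pow_mul_sum_injective_prod_le {W X : Type*} [Fintype W] [Fintype X] [DecidableEq W]
    [DecidableEq X] [DecidablePred (Function.Injective (α := W) (β := X))]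
    {π : X → ℝ} (h0 : ∀ x, 0 ≤ π x) {t : ℝ} (ht : 0 ≤ t) :
    t ^ Fintype.card W * ∑ f : W → X with Function.Injective f, ∏ w, π (f w) ≤
      (Fintype.card W).factorial * ∏ x, (1 + t * π x) := by
  set N := Fintype.card W with hN
  have hmaps : ∀ f ∈ Finset.univ.filter (Function.Injective (α := W) (β := X)),
      Finset.univ.image f ∈ Finset.powersetCard N (Finset.univ : Finset X) := by
    intro f hf
    simp only [Finset.mem_filter, Finset.mem_univ, true_and] at hf
    simp [Finset.mem_powersetCard, Finset.card_image_of_injective _ hf, hN]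
  rw [← Finset.sum_fiberwise_of_maps_to hmaps, Finset.mul_sum, Finset.prod_one_add,
    Finset.mul_sum]
  refine le_trans (Finset.sum_le_sum (g := fun S ↦ (N.factorial : ℝ) * ∏ x ∈ S, t * π x) ?_)
    (Finset.sum_le_sum_of_subset_of_nonneg (fun S _ ↦ by simp) fun S _ _ ↦
      mul_nonneg (by positivity) (Finset.prod_nonneg fun x _ ↦ mul_nonneg ht (h0 x)))
  intro S hS
  have hcard : S.card = N := (Finset.mem_powersetCard.1 hS).2
  have hsum : ∑ f ∈ (Finset.univ.filter (Function.Injective (α := W) (β := X))) with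
      Finset.univ.image f = S, ∏ w, π (f w) =
      ((Finset.univ.filter (Function.Injective (α := W) (β := X))).filter
        fun f ↦ Finset.univ.image f = S).card * ∏ x ∈ S, π x := by
    rw [← nsmul_eq_mul, ← Finset.sum_const]
    refine Finset.sum_congr rfl fun f hf ↦ ?_
    simp only [Finset.mem_filter, Finset.mem_univ, true_and] at hf
    rw [← hf.2, Finset.prod_image hf.1.injOn]
  have hle : ((Finset.univ.filter (Function.Injective (α := W) (β := X))).filter
      fun f ↦ Finset.univ.image f = S).card ≤ N.factorial := by
    calc _ ≤ ((Finset.univ : Finset (W ↪ S)).image fun g w ↦ (g w : X)).card := by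
          refine Finset.card_le_card fun f hf ↦ ?_
          simp only [Finset.mem_filter, Finset.mem_univ, true_and] at hf
          refine Finset.mem_image.2 ⟨⟨fun w ↦ ⟨f w, ?_⟩, fun a b hab ↦ ?_⟩, Finset.mem_univ _, rfl⟩
          · rw [← hf.2]
            simp
          · exact hf.1 (by simpa using hab)
      _ ≤ Fintype.card (W ↪ S) := Finset.card_image_le
      _ = N.factorial := by
          rw [Fintype.card_embedding_eq, Fintype.card_coe, hcard, ← hN, Nat.descFactorial_self]
  rw [hsum, Finset.prod_mul_distrib, Finset.prod_const, hcard]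
  have hprod : 0 ≤ ∏ x ∈ S, π x := Finset.prod_nonneg fun x _ ↦ h0 x
  calc t ^ N * (_ * ∏ x ∈ S, π x) ≤ t ^ N * (N.factorial * ∏ x ∈ S, π x) := by gcongr
    _ = _ := by ring

/-- If `|W|` independent samples are drawn from a distribution `π` with collision probability
`s ^ 2`, then the probability that they are distinct decays exponentially in `|W| * s`. -/
lemma sum_injective_prod_le_exp {W X : Type*} [Fintype W] [Fintype X] [DecidableEq W]
    [DecidableEq X] [DecidablePred (Function.Injective (α := W) (β := X))]
    {π : X → ℝ} (h0 : ∀ x, 0 ≤ π x) (h1 : ∑ x, π x = 1) {s : ℝ} (hs : 0 ≤ s)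
    (hs2 : ∑ x, π x ^ 2 = s ^ 2) (hW : 1 ≤ Fintype.card W * s) :
    ∑ f : W → X with Function.Injective f, ∏ w, π (f w) ≤
      Real.exp 1 * Fintype.card W * Real.exp (-(Fintype.card W * s / 8)) := by
  set N := Fintype.card W with hN
  have hN1 : 1 ≤ N := by
    rcases Nat.eq_zero_or_pos N with h | h
    · norm_num [h] at hW
    · exact h
  have hN0 : (0 : ℝ) < N := by exact_mod_cast hN1
  -- The generating polynomial is evaluated at `t = N`, where it is of the order of its
  -- coefficient of degree `N`.
  have h := pow_mul_sum_injective_prod_le (W := W) h0 hN0.le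
  have h2 := prod_one_add_le_exp h0 h1 hs hs2 hN0.le
  have h3 := factorial_mul_exp_le hN1
  have h4 : (N * s : ℝ) / 8 ≤ (N * s) ^ 2 / (4 * (1 + N * s)) := by
    rw [div_le_div_iff₀ (by norm_num) (by positivity)]
    nlinarith
  have hpow : (0 : ℝ) < (N : ℝ) ^ N := by positivity
  refine le_of_mul_le_mul_left (h.trans ?_) hpow
  calc (N.factorial : ℝ) * ∏ x, (1 + N * π x)
      ≤ N.factorial * Real.exp (N - N * s / 8) := by
        refine mul_le_mul_of_nonneg_left (h2.trans (Real.exp_le_exp.2 ?_)) (by positivity)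
        linarith
    _ = N.factorial * Real.exp N * Real.exp (-(N * s / 8)) := by
        rw [sub_eq_add_neg, Real.exp_add, mul_assoc]
    _ ≤ Real.exp 1 * N * (N : ℝ) ^ N * Real.exp (-(N * s / 8)) := by gcongr
    _ = _ := by ring

/-! ### Resolving sets of `A*` -/

namespace SimpleGraph
variable {V : Type*}

/-- The diagonal entries `2` of `A*` separate each vertex of `R` from all other vertices, so that
only pairs of vertices outside `R` matter. -/
lemma resolves_adjMatrixStar_iff {G : SimpleGraph V} {R : Set V} :
    G.adjMatrixStar.Resolves R ↔
      ∀ u ∉ R, ∀ v ∉ R, u ≠ v → ∃ r ∈ R, ¬ (G.Adj u r ↔ G.Adj v r) := by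
  classical
  have hne {u r : V} (h : u ≠ r) : G.adjMatrixStar u r = if G.Adj u r then 1 else 0 := by
    simp [adjMatrixStar, Matrix.diagonal_apply_ne _ h, adjMatrix_apply]
  have heq (u : V) : G.adjMatrixStar u u = 2 := by simp [adjMatrixStar]
  constructor
  · intro h u hu v hv huv
    obtain ⟨r, hr, hr'⟩ := h u v huv
    refine ⟨r, hr, fun hadj ↦ hr' ?_⟩
    rw [hne (by rintro rfl; exact hu hr), hne (by rintro rfl; exact hv hr)]
    simp [hadj]
  · intro h u v huv
    by_cases hu : u ∈ R
    · refine ⟨u, hu, ?_⟩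
      rw [heq, hne huv.symm]
      split_ifs <;> norm_num
    by_cases hv : v ∈ R
    · refine ⟨v, hv, ?_⟩
      rw [heq, hne huv]
      split_ifs <;> norm_num
    obtain ⟨r, hr, hr'⟩ := h u hu v hv huv
    refine ⟨r, hr, ?_⟩
    rw [hne (by rintro rfl; exact hu hr), hne (by rintro rfl; exact hv hr)]
    by_cases h1 : G.Adj u r <;> by_cases h2 : G.Adj v r <;> simp_all

variable [Fintype V] (p : I)

/-- The probability that two vertices outside `R` have the same neighbours in `R` is at most the
expected number of such pairs. -/
lemma measureReal_exists_adj_iff_adj_le {κ : Type*} [Fintype κ] {R : κ → V}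
    (hR : Function.Injective R) :
    (binomialRandom V p).real {G | ∃ u v, u ≠ v ∧ (∀ i, R i ≠ u) ∧ (∀ i, R i ≠ v) ∧
      ∀ i, (G.Adj u (R i) ↔ G.Adj v (R i))} ≤
      (Fintype.card V).choose 2 * ((p : ℝ) ^ 2 + (1 - p) ^ 2) ^ Fintype.card κ := by
  classical
  have hsub : {G : SimpleGraph V | ∃ u v, u ≠ v ∧ (∀ i, R i ≠ u) ∧ (∀ i, R i ≠ v) ∧
      ∀ i, (G.Adj u (R i) ↔ G.Adj v (R i))} ⊆
      ⋃ T ∈ Finset.powersetCard 2 (Finset.univ : Finset V), {G | ∃ u ∈ T, ∃ v ∈ T, u ≠ v ∧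
        (∀ i, R i ≠ u) ∧ (∀ i, R i ≠ v) ∧ ∀ i, (G.Adj u (R i) ↔ G.Adj v (R i))} := by
    rintro G ⟨u, v, huv, h⟩
    refine Set.mem_iUnion₂.2 ⟨{u, v}, ?_, u, by simp, v, by simp, huv, h⟩
    simp [Finset.mem_powersetCard, Finset.card_pair huv]
  refine (measureReal_mono hsub (measure_ne_top _ _)).trans
    ((measureReal_biUnion_finset_le _ _).trans ?_)
  refine (Finset.sum_le_card_nsmul _ _ (((p : ℝ) ^ 2 + (1 - p) ^ 2) ^ Fintype.card κ)
    fun T hT ↦ ?_).trans (le_of_eq ?_)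
  · obtain ⟨a, b, hab, rfl⟩ := Finset.card_eq_two.1 (Finset.mem_powersetCard.1 hT).2
    by_cases h : (∀ i, R i ≠ a) ∧ ∀ i, R i ≠ b
    · rw [← measureReal_adj_iff_adj p hR hab h.1 h.2]
      refine measureReal_mono ?_
      rintro G ⟨u, hu, v, hv, huv, -, -, hadj⟩ i
      have := hadj i
      simp only [Finset.mem_insert, Finset.mem_singleton] at hu hv
      rcases hu with rfl | rfl <;> rcases hv with rfl | rfl <;> tauto
    · have : {G : SimpleGraph V | ∃ u ∈ ({a, b} : Finset V), ∃ v ∈ ({a, b} : Finset V), u ≠ v ∧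
          (∀ i, R i ≠ u) ∧ (∀ i, R i ≠ v) ∧ ∀ i, (G.Adj u (R i) ↔ G.Adj v (R i))} = ∅ := by
        refine Set.eq_empty_of_forall_notMem ?_
        rintro G ⟨u, hu, v, hv, huv, h1, h2, -⟩
        simp only [Finset.mem_insert, Finset.mem_singleton] at hu hv
        rcases hu with rfl | rfl <;> rcases hv with rfl | rfl <;> tauto
      rw [this, measureReal_empty]
      positivity
  · simp [Finset.card_powersetCard]

/-- The upper bound. Among `k` disjoint sets of `r` columns, each separates the rows outside all
`k` sets with probability at least `1 / 2`, and these events are independent. The remaining pairs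
of rows, of which one lies in another of the `k` sets, collide with small probability. -/
lemma measureReal_not_exists_resolves_le {k r : ℕ} (hkr : k * r ≤ Fintype.card V)
    (hQ : (Fintype.card V : ℝ) ^ 2 * ((p : ℝ) ^ 2 + (1 - p) ^ 2) ^ r ≤ 1) :
    (binomialRandom V p).real {G | ¬ ∃ R : Set V, R.encard = r ∧ G.adjMatrixStar.Resolves R} ≤
      (1 / 2) ^ k + (k * (k * r) * Fintype.card V : ℕ) * ((p : ℝ) ^ 2 + (1 - p) ^ 2) ^ r := by
  classical
  obtain ⟨φ⟩ : Nonempty (Fin k × Fin r ↪ V) :=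
    Function.Embedding.nonempty_of_card_le (by simpa using hkr)
  have hφ (i : Fin k) : Function.Injective fun j ↦ φ (i, j) := fun a b h ↦ by
    simpa using φ.injective h
  let W := {u : V // ∀ x, φ x ≠ u}
  -- `W` is the set of vertices outside all `k` sets; `S` is the set of patterns with a collision
  -- in `W`; `F` collects the collisions of a vertex in the `k` sets with another vertex.
  let e : Fin k → W × Fin r → Sym2 V := fun i x ↦ s(x.1.1, φ (i, x.2))
  let S : Set (W × Fin r → Bool) := {g | ∃ u v : W, u ≠ v ∧ ∀ j, g (u, j) = g (v, j)}
  let F : Fin k × (Fin k × Fin r) × V → Set (SimpleGraph V) := fun x ↦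
    {G | φ x.2.1 ≠ x.2.2 ∧ (∀ j, φ (x.1, j) ≠ φ x.2.1) ∧ (∀ j, φ (x.1, j) ≠ x.2.2) ∧
      ∀ j, (G.Adj (φ x.2.1) (φ (x.1, j)) ↔ G.Adj x.2.2 (φ (x.1, j)))}
  have hsub : {G : SimpleGraph V | ¬ ∃ R : Set V, R.encard = r ∧ G.adjMatrixStar.Resolves R} ⊆
      {G | ∀ i, edgeIndicator (e i) G ∈ S} ∪ ⋃ x, F x := by
    intro G hG
    by_contra hcon
    simp only [Set.mem_union, not_or, Set.mem_ofPred_eq, not_forall, Set.mem_iUnion,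
      not_exists] at hcon
    obtain ⟨⟨i, hi⟩, hF⟩ := hcon
    refine hG ⟨Set.range fun j ↦ φ (i, j), ?_, ?_⟩
    · rw [← Set.image_univ, (hφ i).encard_image]
      simp
    · rw [resolves_adjMatrixStar_iff]
      intro u hu v hv huv
      by_contra hno
      simp only [Set.mem_range, not_exists, exists_exists_eq_and, not_not] at hu hv hno
      by_cases hu' : ∃ x, φ x = u
      · obtain ⟨x, rfl⟩ := hu'
        exact hF (i, x, v) ⟨huv, hu, hv, hno⟩
      by_cases hv' : ∃ x, φ x = v
      · obtain ⟨x, rfl⟩ := hv'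
        exact hF (i, x, u) ⟨huv.symm, hv, hu, fun j ↦ (hno j).symm⟩
      simp only [not_exists] at hu' hv'
      refine hi ⟨⟨u, hu'⟩, ⟨v, hv'⟩, fun h ↦ huv (congrArg Subtype.val h), fun j ↦ ?_⟩
      simp [edgeIndicator, e, hno j]
  have hd (i : Fin k) (x : W × Fin r) : ¬ (e i x).IsDiag := by
    simpa [e] using (x.1.2 (i, x.2)).symm
  have he : Function.Injective (Function.uncurry e) := by
    rintro ⟨i, ⟨u, hu⟩, a⟩ ⟨j, ⟨v, hv⟩, b⟩ h
    simp only [Function.uncurry, e, Sym2.eq_iff] at h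
    rcases h with ⟨rfl, h⟩ | ⟨h, -⟩
    · simpa using φ.injective h
    · exact absurd h.symm (hu _)
  have hE (i : Fin k) : (binomialRandom V p).real {G | edgeIndicator (e i) G ∈ S} ≤ 1 / 2 := by
    refine (measureReal_mono ?_).trans
      ((measureReal_exists_adj_iff_adj_le p (hφ i)).trans ?_)
    · rintro G ⟨u, v, huv, h⟩
      refine ⟨u, v, fun h ↦ huv (Subtype.ext h), fun j ↦ u.2 _, fun j ↦ v.2 _, fun j ↦ ?_⟩
      simpa [edgeIndicator, e] using h j
    · rw [Fintype.card_fin, Nat.cast_choose_two]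
      have : 0 ≤ (Fintype.card V : ℝ) * ((p : ℝ) ^ 2 + (1 - p) ^ 2) ^ r := by positivity
      nlinarith
  have hFle (x) : (binomialRandom V p).real (F x) ≤ ((p : ℝ) ^ 2 + (1 - p) ^ 2) ^ r := by
    by_cases h : φ x.2.1 ≠ x.2.2 ∧ (∀ j, φ (x.1, j) ≠ φ x.2.1) ∧ (∀ j, φ (x.1, j) ≠ x.2.2)
    · have := measureReal_adj_iff_adj p (hφ x.1) h.1 h.2.1 h.2.2
      rw [Fintype.card_fin] at this
      rw [← this]
      exact measureReal_mono fun G hG ↦ hG.2.2.2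
    · have : F x = ∅ := Set.eq_empty_of_forall_notMem fun G hG ↦ h ⟨hG.1, hG.2.1, hG.2.2.1⟩
      rw [this, measureReal_empty]
      positivity
  refine (measureReal_mono hsub).trans ((measureReal_union_le _ _).trans (add_le_add ?_ ?_))
  · rw [measureReal_forall_edgeIndicator_mem p he hd fun _ ↦ S]
    refine (Finset.prod_le_prod (fun _ _ ↦ measureReal_nonneg) fun i _ ↦ hE i).trans ?_
    simp
  · refine (measureReal_iUnion_fintype_le _).trans ?_
    refine (Finset.sum_le_card_nsmul _ _ _ fun x _ ↦ hFle x).trans (le_of_eq ?_)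
    rw [nsmul_eq_mul]
    simp [Fintype.card_prod, mul_assoc]

/-- A fixed set `R` of columns resolves `A*` with exponentially small probability, provided that
`|V \ R| * (p ^ 2 + (1 - p) ^ 2) ^ (|R| / 2)` is large. -/
lemma measureReal_resolves_le (R : Finset V) {s : ℝ} (hs : 0 ≤ s)
    (hs2 : s ^ 2 = ((p : ℝ) ^ 2 + (1 - p) ^ 2) ^ R.card)
    (hN : 1 ≤ (Fintype.card V - R.card : ℕ) * s) :
    (binomialRandom V p).real {G | G.adjMatrixStar.Resolves (R : Set V)} ≤
      Real.exp 1 * (Fintype.card V - R.card : ℕ) *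
        Real.exp (-((Fintype.card V - R.card : ℕ) * s / 8)) := by
  classical
  let W := {u : V // u ∉ R}
  have hW : Fintype.card W = Fintype.card V - R.card := by
    simp [W]
  let e : W × R → Sym2 V := fun x ↦ s(x.1.1, x.2.1)
  have hd (x : W × R) : ¬ (e x).IsDiag := by
    have : x.1.1 ≠ x.2.1 := fun h ↦ x.1.2 (h ▸ x.2.2)
    simpa [e] using this
  have he : Function.Injective e := by
    rintro ⟨⟨u, hu⟩, ⟨a, ha⟩⟩ ⟨⟨v, hv⟩, ⟨b, hb⟩⟩ h
    simp only [e, Sym2.eq_iff] at h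
    rcases h with ⟨rfl, rfl⟩ | ⟨rfl, -⟩
    · rfl
    · exact absurd hb hu
  -- The rows outside `R`, restricted to `R`, are independent samples from the distribution `π` on
  -- `R → Bool`, whose collision probability is `(p ^ 2 + (1 - p) ^ 2) ^ |R|`.
  let π : (R → Bool) → ℝ := fun x ↦ ∏ r, bernoulliWeight p (x r)
  have hπ0 (x : R → Bool) : 0 ≤ π x :=
    Finset.prod_nonneg fun r _ ↦ bernoulliWeight_nonneg p.2.1 p.2.2 _
  have hπ1 : ∑ x, π x = 1 := by
    simp only [π]
    rw [← Fintype.piFinset_univ, ← Finset.prod_univ_sum]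
    simp [bernoulliWeight]
  have hπ2 : ∑ x, π x ^ 2 = s ^ 2 := by
    simp only [π, ← Finset.prod_pow]
    rw [← Fintype.piFinset_univ,
      ← Finset.prod_univ_sum (fun _ ↦ Finset.univ) fun (_ : R) b ↦ bernoulliWeight p b ^ 2]
    simp only [sum_bernoulliWeight_sq]
    simp [hs2]
  have hsum := sum_injective_prod_le_exp (W := W) hπ0 hπ1 hs hπ2 (by rwa [hW])
  rw [hW] at hsum
  refine le_trans (le_trans (measureReal_mono ?_) (le_of_eq
    (measureReal_edgeIndicator_mem p he hd {g | Function.Injective (Function.curry g)})))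
    (le_trans (le_of_eq ?_) hsum)
  · intro G hG u v huv
    by_contra hne
    obtain ⟨r, hr, hr'⟩ := resolves_adjMatrixStar_iff.1 hG u (by simpa using u.2) v
      (by simpa using v.2) (fun h ↦ hne (Subtype.ext h))
    have := congrFun huv ⟨r, hr⟩
    simp [edgeIndicator, e, Function.curry] at this
    exact hr' this
  · refine Finset.sum_equiv (Equiv.curry W R Bool) (fun g ↦ ?_) (fun g _ ↦ ?_)
    · simp
    · rw [Fintype.prod_prod_type]
      rfl

/-- The lower bound: a union bound over all sets of `m` columns. -/
lemma measureReal_metricDim_le_le {m : ℕ} (hm : m ≤ Fintype.card V) {s : ℝ} (hs : 0 ≤ s)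
    (hs2 : s ^ 2 = ((p : ℝ) ^ 2 + (1 - p) ^ 2) ^ m)
    (hN : 1 ≤ (Fintype.card V - m : ℕ) * s) :
    (binomialRandom V p).real {G | G.adjMatrixStar.metricDim ≤ m} ≤
      (Fintype.card V : ℝ) ^ m * (Real.exp 1 * (Fintype.card V - m : ℕ) *
        Real.exp (-((Fintype.card V - m : ℕ) * s / 8))) := by
  classical
  have hsub : {G : SimpleGraph V | G.adjMatrixStar.metricDim ≤ m} ⊆
      ⋃ R ∈ Finset.powersetCard m (Finset.univ : Finset V),
        {G | G.adjMatrixStar.Resolves (R : Set V)} := by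
    intro G hG
    have hlt : G.adjMatrixStar.metricDim < ((m + 1 : ℕ) : ℕ∞) :=
      lt_of_le_of_lt hG (by exact_mod_cast Nat.lt_succ_self m)
    simp only [Matrix.metricDim, iInf_lt_iff] at hlt
    obtain ⟨R, hR, hcard⟩ := hlt
    have hcard' : R.toFinset.card ≤ m := by
      rw [Set.encard_eq_coe_toFinset_card] at hcard
      exact Nat.lt_succ_iff.1 (by exact_mod_cast hcard)
    obtain ⟨T, hRT, hT⟩ := Finset.exists_superset_card_eq hcard' hm
    refine Set.mem_iUnion₂.2 ⟨T, by simp [Finset.mem_powersetCard, hT], fun u v huv ↦ ?_⟩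
    obtain ⟨r, hr, hr'⟩ := hR u v huv
    exact ⟨r, hRT (by simpa using hr), hr'⟩
  refine (measureReal_mono hsub (measure_ne_top _ _)).trans
    ((measureReal_biUnion_finset_le _ _).trans ?_)
  refine (Finset.sum_le_card_nsmul _ _ (Real.exp 1 * (Fintype.card V - m : ℕ) *
        Real.exp (-((Fintype.card V - m : ℕ) * s / 8))) fun R hR ↦ ?_).trans ?_
  · have hc := (Finset.mem_powersetCard.1 hR).2
    subst hc
    exact measureReal_resolves_le p R hs hs2 hN
  · rw [nsmul_eq_mul, Finset.card_powersetCard, Finset.card_univ]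
    gcongr
    exact_mod_cast Nat.choose_le_pow _ _

end SimpleGraph

/-! ### Asymptotics -/

lemma tendsto_binomialRandom_one {p : ℕ → I} {A : ∀ n : ℕ, Set (SimpleGraph (Fin n))}
    (h : ∀ ε > 0, ∀ᶠ n in Filter.atTop,
      (SimpleGraph.binomialRandom (Fin n) (p n)).real (A n)ᶜ ≤ ε) :
    Filter.Tendsto (fun n ↦ SimpleGraph.binomialRandom (Fin n) (p n) (A n))
      Filter.atTop (nhds 1) := by
  rw [← ENNReal.tendsto_toReal_iff (fun n ↦ measure_ne_top _ _) ENNReal.one_ne_top,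
    ENNReal.toReal_one, Metric.tendsto_nhds]
  intro ε hε
  filter_upwards [h (ε / 2) (by positivity)] with n hn
  have h1 : (SimpleGraph.binomialRandom (Fin n) (p n)).real (A n) ≤ 1 := measureReal_le_one
  have h2 := measureReal_union_le (μ := SimpleGraph.binomialRandom (Fin n) (p n)) (A n) (A n)ᶜ
  rw [Set.union_compl_self, probReal_univ] at h2
  rw [measureReal_def] at h1 h2
  rw [Real.dist_eq, abs_lt]
  constructor <;> linarith

/-- With `q = min p (1 - p)`, one has `p ^ 2 + (1 - p) ^ 2 = 1 - 2 p (1 - p) ≤ 1 - q`. -/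
lemma min_le_neg_log_sq_add_sq {p : ℝ} (h0 : 0 ≤ p) (h1 : p ≤ 1) :
    min p (1 - p) ≤ -Real.log (p ^ 2 + (1 - p) ^ 2) := by
  have hQ : 0 < p ^ 2 + (1 - p) ^ 2 := by nlinarith [sq_nonneg (p - (1 - p))]
  have := Real.log_le_sub_one_of_pos hQ
  rcases le_total p (1 - p) with h | h
  · rw [min_eq_left h]
    nlinarith
  · rw [min_eq_right h]
    nlinarith

lemma sq_add_sq_pow_eq_exp (p : ℝ) (m : ℕ) :
    (p ^ 2 + (1 - p) ^ 2) ^ m = Real.exp (-(m * -Real.log (p ^ 2 + (1 - p) ^ 2))) := by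
  have hQ : 0 < p ^ 2 + (1 - p) ^ 2 := by nlinarith [sq_nonneg (p - (1 - p))]
  rw [mul_neg, neg_neg, ← Real.log_pow, Real.exp_log (by positivity)]

lemma eventually_one_le_log_natCast : ∀ᶠ n : ℕ in Filter.atTop, 1 ≤ Real.log n :=
  (Real.tendsto_log_atTop.comp tendsto_natCast_atTop_atTop).eventually_ge_atTop 1

/-- The number of columns in the upper bound is `o(n)`, and it is large enough for two fixed rows to
collide with probability at most `n ^ (-2)`. -/
lemma eventually_ceil_le_and_sq_mul_pow_le {p : ℕ → I}
    (h : (fun n : ℕ ↦ Real.log n / n) =o[Filter.atTop] fun n : ℕ ↦ min (p n : ℝ) (1 - p n))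
    {δ : ℝ} (hδ : 0 < δ) :
    ∀ᶠ n : ℕ in Filter.atTop,
      (⌈-2 * Real.log n / Real.log ((p n : ℝ) ^ 2 + (1 - p n) ^ 2)⌉₊ : ℝ) ≤ δ * n ∧
      (n : ℝ) ^ 2 * ((p n : ℝ) ^ 2 + (1 - p n) ^ 2) ^
        ⌈-2 * Real.log n / Real.log ((p n : ℝ) ^ 2 + (1 - p n) ^ 2)⌉₊ ≤ 1 := by
  filter_upwards [h.bound (c := δ / 4) (by positivity), eventually_one_le_log_natCast,
    tendsto_natCast_atTop_atTop.eventually_ge_atTop (2 / δ),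
    Filter.eventually_gt_atTop 0] with n hn hL hnδ hn0
  have hn0' : (0 : ℝ) < n := by exact_mod_cast hn0
  set L := Real.log n with hLdef
  set q := min (p n : ℝ) (1 - p n) with hq
  have hq0 : 0 ≤ q := le_min (p n).2.1 (by linarith [(p n).2.2])
  rw [Real.norm_of_nonneg hq0, Real.norm_of_nonneg (by positivity), div_le_iff₀ hn0'] at hn
  have hqpos : 0 < q := by
    rcases hq0.lt_or_eq with h | h
    · exact h
    · rw [← h] at hn
      linarith
  have hD := min_le_neg_log_sq_add_sq (p n).2.1 (p n).2.2
  rw [sq_add_sq_pow_eq_exp]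
  set D := -Real.log ((p n : ℝ) ^ 2 + (1 - p n) ^ 2) with hDdef
  have hDpos : 0 < D := hqpos.trans_le hD
  have hquot : -2 * L / Real.log ((p n : ℝ) ^ 2 + (1 - p n) ^ 2) = 2 * L / D := by
    rw [hDdef, div_neg, neg_mul, neg_div]
  rw [hquot]
  constructor
  · have h1 := (Nat.ceil_lt_add_one (a := 2 * L / D) (by positivity)).le
    have h2 : 2 * L / D ≤ δ / 2 * n := by
      rw [div_le_iff₀ hDpos]
      have : δ / 4 * q * n ≤ δ / 4 * D * n := by gcongr
      linarith
    have h3 : 2 ≤ n * δ := by rwa [div_le_iff₀ hδ] at hnδ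
    linarith
  · have h1 : 2 * L ≤ ⌈2 * L / D⌉₊ * D := by
      rw [← div_le_iff₀ hDpos]
      exact Nat.le_ceil _
    rw [← Real.exp_log hn0', ← Real.exp_nat_mul, ← Real.exp_add, Real.exp_le_one_iff]
    push_cast
    linarith

lemma tendsto_binomialRandom_metricDim_le {p : ℕ → I}
    (h : (fun n : ℕ ↦ Real.log n / n) =o[Filter.atTop] fun n : ℕ ↦ min (p n : ℝ) (1 - p n)) :
    Filter.Tendsto
      (fun n : ℕ ↦ SimpleGraph.binomialRandom (Fin n) (p n)
        {G | G.adjMatrixStar.metricDim ≤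
          ((⌈-2 * Real.log n / Real.log ((p n : ℝ) ^ 2 + (1 - p n) ^ 2)⌉₊ : ℕ) : ℕ∞)})
      Filter.atTop (nhds 1) := by
  refine tendsto_binomialRandom_one fun ε hε ↦ ?_
  obtain ⟨k, hk⟩ := exists_pow_lt_of_lt_one (show 0 < ε / 2 by positivity)
    (show (1 / 2 : ℝ) < 1 by norm_num)
  have hδ : 0 < min 1 (ε / 2) / (k ^ 2 + 1 : ℝ) := by positivity
  filter_upwards [eventually_ceil_le_and_sq_mul_pow_le h hδ,
    Filter.eventually_gt_atTop 0] with n hn hn0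
  obtain ⟨h1, h2⟩ := hn
  have hn0' : (0 : ℝ) < n := by exact_mod_cast hn0
  set r := ⌈-2 * Real.log n / Real.log ((p n : ℝ) ^ 2 + (1 - p n) ^ 2)⌉₊
  have hk1 : (k : ℝ) ≤ k ^ 2 + 1 := by nlinarith [sq_nonneg ((k : ℝ) - 1)]
  have h3 : (k ^ 2 + 1) * (r : ℝ) ≤ min 1 (ε / 2) * n := by
    rw [div_mul_eq_mul_div, le_div_iff₀ (by positivity)] at h1
    linarith
  have hkr : k * r ≤ n := by
    have : (k : ℝ) * r ≤ n := calc
      (k : ℝ) * r ≤ (k ^ 2 + 1) * r := by gcongr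
      _ ≤ min 1 (ε / 2) * n := h3
      _ ≤ 1 * n := by gcongr; exact min_le_left _ _
      _ = n := one_mul _
    exact_mod_cast this
  have hmain := SimpleGraph.measureReal_not_exists_resolves_le (V := Fin n) (p n) (k := k) (r := r)
    (by simpa using hkr) (by simpa using h2)
  have hlast : ((k * (k * r) * Fintype.card (Fin n) : ℕ) : ℝ) *
      ((p n : ℝ) ^ 2 + (1 - p n) ^ 2) ^ r ≤ ε / 2 := by
    rw [Fintype.card_fin]
    push_cast
    have h4 : (k : ℝ) * (k * r) ≤ ε / 2 * n := calc
      (k : ℝ) * (k * r) ≤ (k ^ 2 + 1) * r := by nlinarith [(Nat.cast_nonneg r : (0 : ℝ) ≤ r)]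
      _ ≤ min 1 (ε / 2) * n := h3
      _ ≤ ε / 2 * n := by gcongr; exact min_le_right _ _
    calc (k : ℝ) * (k * r) * n * ((p n : ℝ) ^ 2 + (1 - p n) ^ 2) ^ r
        ≤ ε / 2 * n * n * ((p n : ℝ) ^ 2 + (1 - p n) ^ 2) ^ r := by gcongr
      _ = ε / 2 * ((n : ℝ) ^ 2 * ((p n : ℝ) ^ 2 + (1 - p n) ^ 2) ^ r) := by ring
      _ ≤ ε / 2 * 1 := by gcongr
      _ = ε / 2 := mul_one _
  refine (measureReal_mono ?_).trans (hmain.trans (by linarith))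
  rintro G hG ⟨R, hR, hres⟩
  refine hG ?_
  rw [Set.mem_ofPred_eq, ← hR]
  exact iInf₂_le R hres

/-- The numerical estimate behind the lower bound. Here `L = log n`, `m` is the number of columns,
`y = n ^ (1 - C / 2)`, and `q`, `D` stand for `min p (1 - p)`, `- log (p ^ 2 + (1 - p) ^ 2)`. -/
lemma pow_mul_exp_le_exp_neg {n m : ℕ} {C q D : ℝ} (hC1 : 1 < C) (hC2 : C < 2)
    (hL : 1 ≤ Real.log n) (hq0 : 0 ≤ q) (hq1 : q ≤ 1) (hqD : q ≤ D)
    (hy : Real.log n ^ 2 ≤ 1 / 96 * q * (n : ℝ) ^ (1 - C / 2)) (hm : m * D ≤ C * Real.log n) :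
    m ≤ n ∧ 1 ≤ (n - m : ℕ) * Real.exp (-(m * D / 2)) ∧
      (n : ℝ) ^ m * (Real.exp 1 * (n - m : ℕ) *
        Real.exp (-((n - m : ℕ) * Real.exp (-(m * D / 2)) / 8))) ≤
      Real.exp (-((n : ℝ) ^ (1 - C / 2) / 48)) := by
  have hn0 : 0 < n := by
    rcases Nat.eq_zero_or_pos n with rfl | h
    · norm_num at hL
    · exact h
  have hn0' : (0 : ℝ) < n := by exact_mod_cast hn0
  have hn1 : (1 : ℝ) ≤ n := by exact_mod_cast hn0
  have hyexp : (n : ℝ) ^ (1 - C / 2) = Real.exp (Real.log n * (1 - C / 2)) :=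
    Real.rpow_def_of_pos hn0' _
  have hyn : (n : ℝ) ^ (1 - C / 2) ≤ n := by
    calc (n : ℝ) ^ (1 - C / 2) ≤ (n : ℝ) ^ (1 : ℝ) :=
          Real.rpow_le_rpow_of_exponent_le hn1 (by linarith)
      _ = n := Real.rpow_one _
  set y := (n : ℝ) ^ (1 - C / 2) with hydef
  have hy0 : 0 < y := by positivity
  set L := Real.log n with hLdef
  have hqy : q * y ≤ y := by nlinarith
  have hL2 : L ≤ L ^ 2 := by nlinarith
  have hqpos : 0 < q := by
    rcases hq0.lt_or_eq with h | h
    · exact h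
    · rw [← h] at hy
      nlinarith
  -- `m * L ≤ 2 * L ^ 2 / q`, which the hypothesis `hy` bounds by a small multiple of `y`.
  have hmL : m * L ≤ 1 / 48 * y := by
    have h1 : (m : ℝ) * q ≤ 2 * L := by nlinarith [(Nat.cast_nonneg m : (0 : ℝ) ≤ m)]
    have h2 : q * (m * L) ≤ q * (1 / 48 * y) := by nlinarith
    exact le_of_mul_le_mul_left h2 hqpos
  have hm0 : (0 : ℝ) ≤ m := Nat.cast_nonneg m
  have hmn : (m : ℝ) ≤ n / 2 := by nlinarith
  have hmn' : m ≤ n := by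
    have : (m : ℝ) ≤ n := by linarith
    exact_mod_cast this
  have hN : ((n - m : ℕ) : ℝ) = n - m := Nat.cast_sub hmn'
  have hNs : y / 2 ≤ (n - m : ℕ) * Real.exp (-(m * D / 2)) := by
    have h1 : y = n * Real.exp (-(C * L / 2)) := by
      rw [← Real.exp_log hn0', ← hLdef, hyexp, ← Real.exp_add]
      congr 1
      ring
    have h2 : Real.exp (-(C * L / 2)) ≤ Real.exp (-(m * D / 2)) :=
      Real.exp_le_exp.2 (by linarith)
    calc y / 2 = n / 2 * Real.exp (-(C * L / 2)) := by rw [h1]; ring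
      _ ≤ (n - m : ℕ) * Real.exp (-(m * D / 2)) := by
        rw [hN]
        exact mul_le_mul (by linarith) h2 (Real.exp_pos _).le (by linarith)
  refine ⟨hmn', by linarith, ?_⟩
  have hNn : ((n - m : ℕ) : ℝ) ≤ Real.exp L := by
    rw [hLdef, Real.exp_log hn0', hN]
    linarith
  have hpow : (n : ℝ) ^ m = Real.exp (m * L) := by
    rw [Real.exp_nat_mul, hLdef, Real.exp_log hn0']
  calc (n : ℝ) ^ m * (Real.exp 1 * (n - m : ℕ) *
        Real.exp (-((n - m : ℕ) * Real.exp (-(m * D / 2)) / 8)))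
      ≤ Real.exp (m * L) * (Real.exp 1 * Real.exp L * Real.exp (-(y / 16))) := by
        have h1 : Real.exp (-((n - m : ℕ) * Real.exp (-(m * D / 2)) / 8)) ≤
            Real.exp (-(y / 16)) := Real.exp_le_exp.2 (by linarith)
        rw [hpow]
        gcongr
    _ = Real.exp (m * L + 1 + L - y / 16) := by
        rw [← Real.exp_add, ← Real.exp_add, ← Real.exp_add]
        congr 1
        ring
    _ ≤ Real.exp (-(y / 48)) := Real.exp_le_exp.2 (by linarith)

lemma tendsto_binomialRandom_le_metricDim {p : ℕ → I} {C : ℝ} (hC1 : 1 < C) (hC2 : C < 2)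
    (h : (fun n : ℕ ↦ Real.log n ^ 2 / (n : ℝ) ^ (1 - C / 2))
      =o[Filter.atTop] fun n : ℕ ↦ min (p n : ℝ) (1 - p n)) :
    Filter.Tendsto
      (fun n : ℕ ↦ SimpleGraph.binomialRandom (Fin n) (p n)
        {G | ((⌊-C * Real.log n / Real.log ((p n : ℝ) ^ 2 + (1 - p n) ^ 2)⌋₊ : ℕ) : ℕ∞) ≤
          G.adjMatrixStar.metricDim})
      Filter.atTop (nhds 1) := by
  refine tendsto_binomialRandom_one fun ε hε ↦ ?_
  have hlim : Filter.Tendsto (fun n : ℕ ↦ Real.exp (-((n : ℝ) ^ (1 - C / 2) / 48)))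
      Filter.atTop (nhds 0) :=
    Real.tendsto_exp_neg_atTop_nhds_zero.comp
      (((tendsto_rpow_atTop (show 0 < 1 - C / 2 by linarith)).comp
        tendsto_natCast_atTop_atTop).atTop_div_const (by norm_num))
  filter_upwards [h.bound (c := 1 / 96) (by norm_num), eventually_one_le_log_natCast,
    Filter.eventually_gt_atTop 0, hlim.eventually_le_const hε] with n hn hL hn0 hexp
  have hn0' : (0 : ℝ) < n := by exact_mod_cast hn0
  have hq0 : 0 ≤ min (p n : ℝ) (1 - p n) := le_min (p n).2.1 (by linarith [(p n).2.2])
  rw [Real.norm_of_nonneg hq0, Real.norm_of_nonneg (by positivity),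
    div_le_iff₀ (by positivity)] at hn
  have hD := min_le_neg_log_sq_add_sq (p n).2.1 (p n).2.2
  have hpow := sq_add_sq_pow_eq_exp (p n : ℝ)
  set D := -Real.log ((p n : ℝ) ^ 2 + (1 - p n) ^ 2) with hDdef
  have hquot : -C * Real.log n / Real.log ((p n : ℝ) ^ 2 + (1 - p n) ^ 2) =
      C * Real.log n / D := by
    rw [hDdef, div_neg, neg_mul, neg_div]
  rw [hquot]
  -- A metric dimension below `m + 1` is one of at most `m`.
  rcases hr : ⌊C * Real.log n / D⌋₊ with _ | m
  · simpa using hε.le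
  have hD0 : 0 ≤ D := hq0.trans hD
  have hm : m * D ≤ C * Real.log n := by
    have h1 : ((m + 1 : ℕ) : ℝ) ≤ C * Real.log n / D := by
      rw [← hr]
      exact Nat.floor_le (div_nonneg (mul_nonneg (by linarith) (by linarith)) hD0)
    rcases hD0.eq_or_lt with hD0 | hD0
    · rw [← hD0, mul_zero]
      exact mul_nonneg (by linarith) (by linarith)
    · rw [← le_div_iff₀ hD0]
      push_cast at h1
      linarith
  obtain ⟨hmn, hNs, hle⟩ := pow_mul_exp_le_exp_neg hC1 hC2 hL hq0
    ((min_le_left _ _).trans (p n).2.2) hD hn hm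
  have hmain := SimpleGraph.measureReal_metricDim_le_le (V := Fin n) (p n) (m := m)
    (s := Real.exp (-(m * D / 2))) (by simpa using hmn) (Real.exp_pos _).le
    (by rw [hpow, ← Real.exp_nat_mul]; congr 1; push_cast; ring) (by simpa using hNs)
  rw [Fintype.card_fin] at hmain
  refine (measureReal_mono fun G hG ↦ ?_).trans (hmain.trans (hle.trans hexp))
  simp only [Set.mem_compl_iff, Set.mem_ofPred_eq, not_le] at hG ⊢
  rw [Nat.cast_succ] at hG
  exact ENat.lt_natCast_add_one_iff.1 hG

theorem mainTheorem2 (p : ℕ → unitInterval) :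
    ((fun n : ℕ => Real.log n / n)
        =o[Filter.atTop] (fun n : ℕ => min (p n : ℝ) (1 - p n)) →
      Filter.Tendsto
        (fun n : ℕ => SimpleGraph.binomialRandom (Fin n) (p n)
          {G | G.adjMatrixStar.metricDim ≤
            ((⌈-2 * Real.log n / Real.log ((p n : ℝ) ^ 2 + (1 - p n) ^ 2)⌉₊ : ℕ) : ℕ∞)})
        Filter.atTop (nhds 1)) ∧
    (∀ C : ℝ, 1 < C → C < 2 →
      (fun n : ℕ => Real.log n ^ 2 / (n : ℝ) ^ (1 - C / 2))
        =o[Filter.atTop] (fun n : ℕ => min (p n : ℝ) (1 - p n)) →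
      Filter.Tendsto
        (fun n : ℕ => SimpleGraph.binomialRandom (Fin n) (p n)
          {G | ((⌊-C * Real.log n / Real.log ((p n : ℝ) ^ 2 + (1 - p n) ^ 2)⌋₊ : ℕ) : ℕ∞) ≤
            G.adjMatrixStar.metricDim})
        Filter.atTop (nhds 1)) :=
  ⟨tendsto_binomialRandom_metricDim_le,
    fun _ hC1 hC2 h ↦ tendsto_binomialRandom_le_metricDim hC1 hC2 h⟩
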